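/- Let $\mathcal H$ be a separable complex Hilbert space, $(\Omega,\Sigma)$ a measurable space and $\mathsf M:\Sigma\to\mathcal L(\mathcal H)$ a normalized positive-operator-valued measure (POVM). For a state $\rho$ of $\mathcal H$ (a positive trace-one operator) let $p^{\mathsf M}_\rho(X)=\mathrm{tr}[\rho\,\mathsf M(X)]$, $X\in\Sigma$; $\mathsf M$ is called informationally complete within a set $\mathcal P$ of states if $p^{\mathsf M}_\rho\neq p^{\mathsf M}_\sigma$ whenever $\rho,\sigma\in\mathcal P$ and $\rho\ne\sigma$. Let $\mu$ be a $\sigma$-finite positive measure on $(\Omega,\Sigma)$ and let $\mathcal H_\oplus=\int_\Omega^\oplus\mathcal H(x)\,\mathrm d\mu(x)$ be a direct integral of separable Hilbert spaces (square-integrable measurable fields of vectors modulo $\mu$-a.e. equality) with canonical spectral measure $(\mathsf P_\oplus(X)\psi)(x)=\chi_X(x)\psi(x)$. Let $J_\oplus:\mathcal H\to\mathcal H_\oplus$ be a linear isometry such that $(\mathcal H_\oplus,\mathsf P_\oplus,J_\oplus)$ is a minimal Naimark dilation of $\mathsf M$, that is, $\mathsf M(X)=J_\oplus^*\mathsf P_\oplus(X)J_\oplus$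 for all $X\in\Sigma$ and the vectors $\mathsf P_\oplus(X)J_\oplus\varphi$, $X\in\Sigma$, $\varphi\in\mathcal H$, span a dense subspace of $\mathcal H_\oplus$. A bounded operator $W$ on $\mathcal H_\oplus$ is decomposable if there is a weakly $\mu$-measurable field of operators $W(x)\in\mathcal L(\mathcal H(x))$ such that, for every $\psi\in\mathcal H_\oplus$, $(W\psi)(x)=W(x)\psi(x)$ for $\mu$-almost all $x$. Then the following three conditions are equivalent: 1. $\mathsf M$ is informationally complete within the set $\{|\varphi\rangle\langle\varphi| : \varphi\in\mathcal H,\ \|\varphi\|=1\}$ of pure states. 2. $WJ_\oplus\varphi\notin J_\oplus\mathcal H$ whenever $\varphi\in\mathcal H$ and $W\in\mathcal L(\mathcal H_\oplus)$ is a decomposable isometry such that $WJ_\oplus\varphi\neq tJ_\oplus\varphi$ for all $t\in\mathbb C$ with $|t|=1$. 3. $\|Z_W\varphi\|<\|\varphi\|$, where $Z_W=J_\oplus^*WJ_\oplus$, whenever $\varphi\in\mathcal H$ and $W\in\mathcal L(\mathcal H_\oplus)$ is a decomposable isometry such that $WJ_\oplus\varphi\neq tJ_\oplus\varphi$ for all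 $t\in\mathbb C$ with $|t|=1$. -/

import Mathlib

open MeasureTheory Filter Topology
open scoped ENNReal InnerProductSpace

noncomputable section

/-! ## Direct integrals of Hilbert spaces -/

/-- A `μ`-measurable field structure on a family `x ↦ K x` of complex Hilbert spaces: a vector
space of fields of vectors, called the measurable fields, such that
* the norm of every measurable field is a `μ`-measurable function;
* a field whose inner products with all measurable fields are `μ`-measurable is measurable;
* there is a sequence of measurable fields whose values are total in `K x`, for every `x`
  (so that every `K x` is separable). -/
structure MeasurableHilbertField {Ω : Type*} [MeasurableSpace Ω] (μ : Measure Ω) (K : Ω → Type*)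
    [∀ x, NormedAddCommGroup (K x)] [∀ x, InnerProductSpace ℂ (K x)] where
  /-- The measurable fields of vectors. -/
  sections : Submodule ℂ (∀ x, K x)
  aemeasurable_norm : ∀ ξ ∈ sections, AEMeasurable (fun x => ‖ξ x‖) μ
  mem_of_inner : ∀ η : ∀ x, K x,
    (∀ ξ ∈ sections, AEMeasurable (fun x => ⟪ξ x, η x⟫_ℂ) μ) → η ∈ sections
  exists_total : ∃ e : ℕ → ∀ x, K x, (∀ n, e n ∈ sections) ∧
    ∀ x, (Submodule.span ℂ (Set.range fun n => e n x)).topologicalClosure = ⊤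

namespace MeasurableHilbertField

variable {Ω : Type*} [MeasurableSpace Ω] {μ : Measure Ω} {K : Ω → Type*}
  [∀ x, NormedAddCommGroup (K x)] [∀ x, InnerProductSpace ℂ (K x)]

theorem aemeasurable_inner (F : MeasurableHilbertField μ K) {ξ η : ∀ x, K x}
    (hξ : ξ ∈ F.sections) (hη : η ∈ F.sections) :
    AEMeasurable (fun x => ⟪ξ x, η x⟫_ℂ) μ := by
  simp_rw [inner_eq_sum_norm_sq_div_four]
  have h1 := F.aemeasurable_norm _ (F.sections.add_mem hξ hη)
  have h2 := F.aemeasurable_norm _ (F.sections.sub_mem hξ hη)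
  have h3 := F.aemeasurable_norm _ (F.sections.sub_mem hξ (F.sections.smul_mem Complex.I hη))
  have h4 := F.aemeasurable_norm _ (F.sections.add_mem hξ (F.sections.smul_mem Complex.I hη))
  simp only [Pi.add_apply, Pi.sub_apply, Pi.smul_apply] at h1 h2 h3 h4
  have e1 := Complex.measurable_ofReal.comp_aemeasurable h1
  have e2 := Complex.measurable_ofReal.comp_aemeasurable h2
  have e3 := Complex.measurable_ofReal.comp_aemeasurable h3
  have e4 := Complex.measurable_ofReal.comp_aemeasurable h4
  exact ((((e1.pow_const 2).sub (e2.pow_const 2)).add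
    (((e3.pow_const 2).sub (e4.pow_const 2)).mul_const _)).div_const _)

/-- Multiplying a measurable field by a measurable scalar function gives a measurable field. -/
theorem smul_mem_sections (F : MeasurableHilbertField μ K) {f : Ω → ℂ} (hf : AEMeasurable f μ)
    {ξ : ∀ x, K x} (hξ : ξ ∈ F.sections) : (fun x => f x • ξ x) ∈ F.sections := by
  refine F.mem_of_inner _ fun η hη => ?_
  simp_rw [inner_smul_right]
  exact hf.mul (F.aemeasurable_inner hη hξ)

/-- The square-integrable measurable fields. -/
def sqIntegrable (F : MeasurableHilbertField μ K) : Submodule ℂ (∀ x, K x) where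
  carrier := {ξ | ξ ∈ F.sections ∧ MemLp (fun x => ‖ξ x‖) 2 μ}
  zero_mem' := ⟨F.sections.zero_mem, by simp⟩
  add_mem' := by
    rintro ξ η ⟨h1, h2⟩ ⟨h3, h4⟩
    refine ⟨F.sections.add_mem h1 h3, (h2.add h4).mono
      (F.aemeasurable_norm _ (F.sections.add_mem h1 h3)).aestronglyMeasurable ?_⟩
    refine ae_of_all _ fun x => ?_
    simp only [Pi.add_apply, norm_norm]
    exact (norm_add_le _ _).trans (le_abs_self _)
  smul_mem' := by
    rintro c ξ ⟨h1, h2⟩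
    refine ⟨F.sections.smul_mem c h1, ?_⟩
    simpa [norm_smul] using h2.const_mul ‖c‖

/-- The type of square-integrable measurable fields, with the seminorm
`‖ξ‖² = ∫ ‖ξ x‖² dμ` (see below). -/
def L2Field (F : MeasurableHilbertField μ K) : Type _ := ↥F.sqIntegrable

namespace L2Field

variable {F : MeasurableHilbertField μ K}

instance : AddCommGroup F.L2Field := inferInstanceAs (AddCommGroup ↥F.sqIntegrable)

instance : Module ℂ F.L2Field := inferInstanceAs (Module ℂ ↥F.sqIntegrable)

instance : CoeFun F.L2Field (fun _ => ∀ x, K x) := ⟨fun ξ => ξ.1⟩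

theorem add_apply (ξ η : F.L2Field) (x : Ω) : (ξ + η) x = ξ x + η x := rfl

theorem sub_apply (ξ η : F.L2Field) (x : Ω) : (ξ - η) x = ξ x - η x := rfl

theorem smul_apply (c : ℂ) (ξ : F.L2Field) (x : Ω) : (c • ξ) x = c • ξ x := rfl

theorem mem_sections (ξ : F.L2Field) : (ξ : ∀ x, K x) ∈ F.sections := ξ.2.1

theorem memLp (ξ : F.L2Field) : MemLp (fun x => ‖ξ x‖) 2 μ := ξ.2.2

theorem integrable_inner (ξ η : F.L2Field) : Integrable (fun x => ⟪ξ x, η x⟫_ℂ) μ := by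
  refine (ξ.memLp.integrable_mul η.memLp).mono
    (F.aemeasurable_inner ξ.mem_sections η.mem_sections).aestronglyMeasurable ?_
  refine ae_of_all _ fun x => ?_
  simpa using norm_inner_le_norm (𝕜 := ℂ) (ξ x) (η x)

/-- The inner product `⟪ξ, η⟫ = ∫ ⟪ξ x, η x⟫ dμ`. -/
instance core : PreInnerProductSpace.Core ℂ F.L2Field where
  inner ξ η := ∫ x, ⟪ξ x, η x⟫_ℂ ∂μ
  conj_inner_symm ξ η := by
    rw [← integral_conj]
    simp
  re_inner_nonneg ξ := by
    rw [← integral_re (integrable_inner ξ ξ)]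
    exact integral_nonneg fun x => inner_self_nonneg
  add_left ξ η ζ := by
    rw [← integral_add (integrable_inner ξ ζ) (integrable_inner η ζ)]
    simp [add_apply]
  smul_left ξ η r := by
    rw [← integral_const_mul]
    refine integral_congr_ae (ae_of_all _ fun x => ?_)
    simp [smul_apply, mul_comm]

instance : SeminormedAddCommGroup F.L2Field :=
  InnerProductSpace.Core.toSeminormedAddCommGroup (𝕜 := ℂ)

instance : InnerProductSpace ℂ F.L2Field := InnerProductSpace.ofCore core

theorem inner_def (ξ η : F.L2Field) : ⟪ξ, η⟫_ℂ = ∫ x, ⟪ξ x, η x⟫_ℂ ∂μ := rfl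

theorem norm_sq_eq (ξ : F.L2Field) : ‖ξ‖ ^ 2 = ∫ x, ‖ξ x‖ ^ 2 ∂μ := by
  rw [← inner_self_eq_norm_sq (𝕜 := ℂ), inner_def, ← integral_re (integrable_inner ξ ξ)]
  exact integral_congr_ae (ae_of_all _ fun x => inner_self_eq_norm_sq _)

theorem eLpNorm_eq (ξ : F.L2Field) : eLpNorm (fun x => ‖ξ x‖) 2 μ = ENNReal.ofReal ‖ξ‖ := by
  rw [ξ.memLp.eLpNorm_eq_integral_rpow_norm two_ne_zero ENNReal.ofNat_ne_top]
  congr 1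
  have h : (∫ x, ‖‖ξ x‖‖ ^ (2 : ℝ≥0∞).toReal ∂μ) = ‖ξ‖ ^ 2 := by
    rw [norm_sq_eq]; simp
  rw [h]
  simpa using Real.pow_rpow_inv_natCast (norm_nonneg ξ) two_ne_zero

theorem norm_eq_zero_iff (ξ : F.L2Field) : ‖ξ‖ = 0 ↔ ∀ᵐ x ∂μ, ξ x = 0 := by
  have h := ξ.eLpNorm_eq
  constructor
  · intro h0
    rw [h0, ENNReal.ofReal_zero, eLpNorm_eq_zero_iff ξ.memLp.1 two_ne_zero] at h
    filter_upwards [h] with x hx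
    simpa using hx
  · intro h0
    rw [← sq_eq_zero_iff, norm_sq_eq]
    refine integral_eq_zero_of_ae ?_
    filter_upwards [h0] with x hx
    simp [hx]

theorem inseparable_iff (ξ η : F.L2Field) : Inseparable ξ η ↔ ∀ᵐ x ∂μ, ξ x = η x := by
  rw [Metric.inseparable_iff, dist_eq_norm, norm_eq_zero_iff]
  simp [sub_apply, sub_eq_zero]

/-- Riesz–Fischer: square-integrable fields of complete spaces form a complete space. -/
instance [∀ x, CompleteSpace (K x)] : CompleteSpace F.L2Field := by
  classical
  refine Metric.complete_of_convergent_controlled_sequences (fun n => (1 / 2 : ℝ) ^ n)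
    (fun n => by positivity) fun u hu => ?_
  have hstep (n : ℕ) : eLpNorm (fun x => ‖u (n + 1) x - u n x‖) 2 μ
      ≤ ENNReal.ofReal ((1 / 2 : ℝ) ^ n) := by
    have h := (hu n (n + 1) n (Nat.le_succ n) le_rfl).le
    rw [dist_eq_norm] at h
    exact ((u (n + 1) - u n).eLpNorm_eq).le.trans (ENNReal.ofReal_le_ofReal h)
  let g : ℕ → Ω → ℝ := fun n x => ‖u (n + 1) x - u n x‖
  have hg (n : ℕ) : AEStronglyMeasurable (g n) μ := (u (n + 1) - u n).memLp.1
  let S : ℕ → Ω → ℝ := fun n => ∑ i ∈ Finset.range n, g i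
  have hS (n : ℕ) : AEStronglyMeasurable (S n) μ :=
    Finset.aestronglyMeasurable_sum _ fun i _ => hg i
  have hgeom (N n : ℕ) : ∑ i ∈ Finset.Ico N n, (1 / 2 : ℝ) ^ i ≤ 2 * (1 / 2 : ℝ) ^ N := by
    rcases le_total N n with h | h
    · rw [Finset.sum_Ico_eq_sum_range]
      simp_rw [pow_add, ← Finset.mul_sum]
      rw [mul_comm]
      gcongr
      exact sum_geometric_two_le _
    · rw [Finset.Ico_eq_empty_of_le h]
      simp
  have hle (N n m : ℕ) (hn : N ≤ n) (hnm : n ≤ m) :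
      eLpNorm (S m - S n) 2 μ ≤ ENNReal.ofReal (2 * (1 / 2 : ℝ) ^ N) := by
    have e : S m - S n = ∑ i ∈ Finset.Ico n m, g i := (Finset.sum_Ico_eq_sub g hnm).symm
    rw [e]
    calc eLpNorm (∑ i ∈ Finset.Ico n m, g i) 2 μ
        ≤ ∑ i ∈ Finset.Ico n m, eLpNorm (g i) 2 μ :=
          eLpNorm_sum_le (fun i _ => hg i) one_le_two
      _ ≤ ∑ i ∈ Finset.Ico n m, ENNReal.ofReal ((1 / 2 : ℝ) ^ i) :=
          Finset.sum_le_sum fun i _ => hstep i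
      _ = ENNReal.ofReal (∑ i ∈ Finset.Ico n m, (1 / 2 : ℝ) ^ i) :=
          (ENNReal.ofReal_sum_of_nonneg fun i _ => by positivity).symm
      _ ≤ ENNReal.ofReal (2 * (1 / 2 : ℝ) ^ N) := by
          refine ENNReal.ofReal_le_ofReal ((hgeom n m).trans ?_)
          have := pow_le_pow_of_le_one (by norm_num : (0 : ℝ) ≤ 1 / 2) (by norm_num) hn
          linarith
  have hlt (N : ℕ) : ENNReal.ofReal (2 * (1 / 2 : ℝ) ^ N) < ENNReal.ofReal (3 * (1 / 2 : ℝ) ^ N) := by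
    refine (ENNReal.ofReal_lt_ofReal_iff (by positivity)).2 ?_
    have : (0 : ℝ) < (1 / 2 : ℝ) ^ N := by positivity
    linarith
  have hconv : ∀ᵐ x ∂μ, ∃ l : ℝ, Tendsto (fun n => S n x) atTop (𝓝 l) := by
    refine Lp.ae_tendsto_of_cauchy_eLpNorm hS one_le_two
      (B := fun N => ENNReal.ofReal (3 * (1 / 2 : ℝ) ^ N)) ?_ fun N n m hn hm => ?_
    · have hs : Summable fun N : ℕ => 3 * (1 / 2 : ℝ) ^ N := summable_geometric_two.mul_left 3
      rw [← ENNReal.ofReal_tsum_of_nonneg (fun _ => by positivity) hs]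
      exact ENNReal.ofReal_ne_top
    · refine lt_of_le_of_lt ?_ (hlt N)
      rcases le_total n m with h | h
      · rw [eLpNorm_sub_comm]
        exact hle N n m hn h
      · exact hle N m n hm h
  have hex : ∀ᵐ x ∂μ, ∃ l : K x, Tendsto (fun n => u n x) atTop (𝓝 l) := by
    filter_upwards [hconv] with x ⟨l, hl⟩
    have hsum : Summable fun i => g i x := by
      refine ((hasSum_iff_tendsto_nat_of_nonneg (fun i => norm_nonneg _) l).2 ?_).summable
      simpa [S] using hl
    refine cauchySeq_tendsto_of_complete (cauchySeq_of_summable_dist (hsum.congr fun i => ?_))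
    rw [dist_eq_norm, norm_sub_rev]
  let ξ : ∀ x, K x := fun x =>
    if h : ∃ l : K x, Tendsto (fun n => u n x) atTop (𝓝 l) then h.choose else 0
  have hξ : ∀ᵐ x ∂μ, Tendsto (fun n => u n x) atTop (𝓝 (ξ x)) := by
    filter_upwards [hex] with x hx
    simp only [ξ, dif_pos hx]
    exact hx.choose_spec
  have hmeas : ξ ∈ F.sections := by
    refine F.mem_of_inner _ fun η hη => ?_
    refine aemeasurable_of_tendsto_metrizable_ae' (f := fun n x => ⟪η x, u n x⟫_ℂ)
      (fun n => F.aemeasurable_inner hη (u n).mem_sections) ?_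
    filter_upwards [hξ] with x hx
    exact tendsto_const_nhds.inner hx
  have hclose (n : ℕ) : eLpNorm (fun x => ‖ξ x - u n x‖) 2 μ
      ≤ ENNReal.ofReal ((1 / 2 : ℝ) ^ n) := by
    refine Lp.eLpNorm_le_of_ae_tendsto (u := atTop) (f := fun m x => ‖u m x - u n x‖) ?_
      (fun m => (u m - u n).memLp.1) ?_
    · filter_upwards [eventually_ge_atTop n] with m hm
      have h := (hu n m n hm le_rfl).le
      rw [dist_eq_norm] at h
      exact ((u m - u n).eLpNorm_eq).le.trans (ENNReal.ofReal_le_ofReal h)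
    · filter_upwards [hξ] with x hx
      exact (hx.sub_const _).norm
  have hsub (n : ℕ) : ξ - u n ∈ F.sqIntegrable := by
    have hm := F.sections.sub_mem hmeas (u n).mem_sections
    exact ⟨hm, (F.aemeasurable_norm _ hm).aestronglyMeasurable,
      (hclose n).trans_lt ENNReal.ofReal_lt_top⟩
  have hmem : ξ ∈ F.sqIntegrable := by
    simpa using F.sqIntegrable.add_mem (hsub 0) (u 0).2
  let ξ' : F.L2Field := ⟨ξ, hmem⟩
  refine ⟨ξ', ?_⟩
  rw [tendsto_iff_norm_sub_tendsto_zero]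
  refine squeeze_zero (fun _ => norm_nonneg _) (fun n => ?_)
    (tendsto_pow_atTop_nhds_zero_of_lt_one (by norm_num : (0 : ℝ) ≤ 1 / 2) (by norm_num))
  rw [norm_sub_rev]
  have h := ((ξ' - u n).eLpNorm_eq).symm.le.trans (hclose n)
  exact (ENNReal.ofReal_le_ofReal_iff (by positivity)).1 h

/-- Multiplication of a square-integrable field by the characteristic function of `X`. -/
def indicator (X : Set Ω) (hX : MeasurableSet X) : F.L2Field →ₗ[ℂ] F.L2Field where
  toFun ξ := ⟨fun x => X.indicator (fun _ => (1 : ℂ)) x • ξ x, by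
    have hm : (fun x => X.indicator (fun _ => (1 : ℂ)) x • ξ x) ∈ F.sections :=
      F.smul_mem_sections (aemeasurable_const.indicator hX) ξ.mem_sections
    refine ⟨hm, ξ.memLp.mono (F.aemeasurable_norm _ hm).aestronglyMeasurable ?_⟩
    refine ae_of_all _ fun x => ?_
    by_cases hx : x ∈ X <;> simp [hx]⟩
  map_add' ξ η := Subtype.ext (funext fun x => smul_add _ _ _)
  map_smul' c ξ := Subtype.ext (funext fun x => smul_comm _ _ _)

theorem indicator_apply (X : Set Ω) (hX : MeasurableSet X) (ξ : F.L2Field) (x : Ω) :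
    indicator X hX ξ x = X.indicator (fun _ => (1 : ℂ)) x • ξ x := rfl

theorem norm_indicator_le (X : Set Ω) (hX : MeasurableSet X) (ξ : F.L2Field) :
    ‖indicator X hX ξ‖ ≤ 1 * ‖ξ‖ := by
  rw [one_mul, ← ENNReal.ofReal_le_ofReal_iff (norm_nonneg _), ← eLpNorm_eq, ← eLpNorm_eq]
  refine eLpNorm_mono fun x => ?_
  rw [indicator_apply]
  by_cases hx : x ∈ X <;> simp [hx]

end L2Field

/-- The direct integral `∫^⊕ K x dμ(x)`: square-integrable measurable fields modulo equality
`μ`-almost everywhere (see `DirectIntegral.mk_eq_mk_iff`). It is a Hilbert space. -/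
abbrev DirectIntegral (F : MeasurableHilbertField μ K) : Type _ := SeparationQuotient F.L2Field

namespace DirectIntegral

variable {F : MeasurableHilbertField μ K}

theorem mk_eq_mk_iff (ξ η : F.L2Field) :
    (SeparationQuotient.mk ξ : F.DirectIntegral) = SeparationQuotient.mk η ↔
      ∀ᵐ x ∂μ, ξ x = η x := by
  rw [SeparationQuotient.mk_eq_mk, L2Field.inseparable_iff]

/-- A square-integrable field `x ↦ ψ(x)` representing the element `ψ` of the direct integral; it
is determined by `ψ` up to equality almost everywhere. -/
def rep (ψ : F.DirectIntegral) : F.L2Field := Quotient.out ψ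

theorem mk_rep (ψ : F.DirectIntegral) : SeparationQuotient.mk ψ.rep = ψ := Quotient.out_eq ψ

/-- The canonical spectral measure: `P(X)` is multiplication by the characteristic function
of `X`. -/
def canonicalPVM (F : MeasurableHilbertField μ K) (X : Set Ω) (hX : MeasurableSet X) :
    F.DirectIntegral →L[ℂ] F.DirectIntegral :=
  SeparationQuotient.liftCLM
    ((SeparationQuotient.mkCLM ℂ F.L2Field).comp
      ((L2Field.indicator X hX).mkContinuous 1 (L2Field.norm_indicator_le X hX)))
    (fun ξ η h => by
      refine (mk_eq_mk_iff _ _).2 ?_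
      filter_upwards [(L2Field.inseparable_iff ξ η).1 h] with x hx
      exact congrArg (fun v => X.indicator (fun _ => (1 : ℂ)) x • v) hx)

theorem canonicalPVM_mk (X : Set Ω) (hX : MeasurableSet X) (ξ : F.L2Field) :
    canonicalPVM F X hX (SeparationQuotient.mk ξ) =
      SeparationQuotient.mk (L2Field.indicator X hX ξ) := rfl

/-- A field of bounded operators `x ↦ D x` is weakly `μ`-measurable. -/
def WeaklyMeasurable (F : MeasurableHilbertField μ K) (D : ∀ x, K x →L[ℂ] K x) : Prop :=
  ∀ ξ ∈ F.sections, ∀ η ∈ F.sections, AEMeasurable (fun x => ⟪ξ x, D x (η x)⟫_ℂ) μ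

/-- A bounded operator `W` on the direct integral is decomposable, `W = ∫^⊕ D x dμ(x)`, if there
is a weakly measurable field of bounded operators `x ↦ D x` such that, for every `ψ`,
`(W ψ)(x) = D x (ψ x)` for almost all `x`. -/
def IsDecomposable (W : F.DirectIntegral →L[ℂ] F.DirectIntegral) : Prop :=
  ∃ D : ∀ x, K x →L[ℂ] K x, WeaklyMeasurable F D ∧
    ∀ ψ : F.DirectIntegral, ∀ᵐ x ∂μ, (W ψ).rep x = D x (ψ.rep x)

end DirectIntegral

end MeasurableHilbertField

/-! ## States and observables -/

section Quantum

variable {H : Type*} [NormedAddCommGroup H] [InnerProductSpace ℂ H] [CompleteSpace H]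

/-- The trace of a trace-class operator, computed in some orthonormal (Hilbert) basis. -/
def opTrace (T : H →L[ℂ] H) : ℂ :=
  ∑' e : ((exists_hilbertBasis ℂ H).choose : Set H), ⟪(e : H), T e⟫_ℂ

theorem opTrace_rankOne_comp (φ : H) (A : H →L[ℂ] H) :
    opTrace ((InnerProductSpace.rankOne ℂ φ φ).comp A) = ⟪φ, A φ⟫_ℂ := by
  obtain ⟨b, hb⟩ := (exists_hilbertBasis ℂ H).choose_spec
  rw [← ContinuousLinearMap.adjoint_inner_left, ← b.tsum_inner_mul_inner, opTrace]
  refine tsum_congr fun e => ?_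
  rw [hb]
  simp [ContinuousLinearMap.adjoint_inner_left, InnerProductSpace.rankOne_apply]

variable (H) in
/-- The states of `H`: positive operators of trace one. -/
structure QState where
  op : H →L[ℂ] H
  isPositive : op.IsPositive
  opTrace_eq_one : opTrace op = 1

/-- The pure state `|φ⟩⟨φ|` of a unit vector `φ`. -/
def pureState (φ : H) (hφ : ‖φ‖ = 1) : QState H where
  op := InnerProductSpace.rankOne ℂ φ φ
  isPositive := InnerProductSpace.isPositive_rankOne_self φ
  opTrace_eq_one := by
    have h := opTrace_rankOne_comp φ (ContinuousLinearMap.id ℂ H)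
    rw [ContinuousLinearMap.comp_id] at h
    simp [h, inner_self_eq_norm_sq_to_K, hφ]

variable (H) in
/-- The set of all pure states `|φ⟩⟨φ|`, `‖φ‖ = 1`. -/
def pureStates : Set (QState H) := {ρ | ∃ (φ : H) (hφ : ‖φ‖ = 1), ρ = pureState φ hφ}

variable (H) in
/-- A normalized positive-operator-valued measure on the measurable space `Ω`. As for
`MeasureTheory.VectorMeasure`, nonmeasurable sets are sent to `0`. -/
structure POVM (Ω : Type*) [MeasurableSpace Ω] where
  toFun : Set Ω → (H →L[ℂ] H)
  not_measurable : ∀ X, ¬ MeasurableSet X → toFun X = 0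
  isPositive : ∀ X, MeasurableSet X → (toFun X).IsPositive
  map_univ : toFun Set.univ = ContinuousLinearMap.id ℂ H
  /-- Weak countable additivity. -/
  hasSum_iUnion : ∀ X : ℕ → Set Ω, (∀ n, MeasurableSet (X n)) →
    Pairwise (Function.onFun Disjoint X) → ∀ φ ψ : H,
      HasSum (fun n => ⟪φ, toFun (X n) ψ⟫_ℂ) ⟪φ, toFun (⋃ n, X n) ψ⟫_ℂ

namespace POVM

variable {Ω : Type*} [MeasurableSpace Ω]

/-- The outcome statistics `p_ρ(X) = tr[ρ M(X)]` of `M` in the state `ρ`. -/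
def prob (M : POVM H Ω) (ρ : QState H) (X : Set Ω) : ℂ := opTrace (ρ.op.comp (M.toFun X))

/-- `M` is informationally complete within a set `P` of states: different states in `P` have
different outcome statistics. -/
def IsInfoCompleteWithin (M : POVM H Ω) (P : Set (QState H)) : Prop :=
  ∀ ρ ∈ P, ∀ σ ∈ P, ρ ≠ σ → ∃ X, MeasurableSet X ∧ M.prob ρ X ≠ M.prob σ X

open MeasurableHilbertField in
/-- The direct integral of the measurable field `F`, its canonical spectral measure `P` and the
linear isometry `J` form a minimal Naimark dilation of `M`: `M(X) = J* P(X) J` for all measurable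
`X`, and the vectors `P(X) J φ` span a dense subspace. -/
def IsMinimalDirectIntegralDilation {μ : Measure Ω} {K : Ω → Type*}
    [∀ x, NormedAddCommGroup (K x)] [∀ x, InnerProductSpace ℂ (K x)] [∀ x, CompleteSpace (K x)]
    (M : POVM H Ω) (F : MeasurableHilbertField μ K) (J : H →ₗᵢ[ℂ] F.DirectIntegral) : Prop :=
  (∀ (X : Set Ω) (hX : MeasurableSet X), M.toFun X =
    (ContinuousLinearMap.adjoint J.toContinuousLinearMap).comp
      ((DirectIntegral.canonicalPVM F X hX).comp J.toContinuousLinearMap)) ∧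
  (Submodule.span ℂ {v : F.DirectIntegral | ∃ (X : Set Ω) (hX : MeasurableSet X) (φ : H),
    v = DirectIntegral.canonicalPVM F X hX (J φ)}).topologicalClosure = ⊤

end POVM

end Quantum

end

/-! The outcome distribution of the pure state of a unit vector `φ` is `X ↦ ‖P(X) J φ‖² = ∫_X ‖(J
φ)(x)‖² dμ`. So two pure states are indistinguishable exactly when the fibre norms of `J φ` and `J
η` agree almost everywhere (`ae_norm_rep_eq`). The equivalence of 1 and 2 rests on identifying such
pairs with the pairs for which `J η = W J φ`, where `W` is a decomposable isometry.

If `J η = W J φ`, the statistics agree because `W` commutes with every `P(X)` and preserves norms.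
Conversely, vectors of equal norm in one fibre are exchanged by a unitary given by an explicit
formula, a phase times a Householder reflection. The formula depends measurably on the two vectors,
so these unitaries form a measurable field, whose direct integral is `W`
(`exists_isDecomposable_isometry_apply_eq`). The states themselves coincide iff `η` is a phase times
`φ`, which is the case that condition 2 excludes.

Conditions 2 and 3 match for each `W` and `φ` separately: `‖W J φ‖ = ‖φ‖`, and `J*` shortens a
vector strictly iff it lies outside the range of `J`. -/

/-! ## A unitary operator exchanging two vectors of equal norm -/

section Householder

variable {E : Type*} [NormedAddCommGroup E] [InnerProductSpace ℂ E]

/-- The phase `z / |z|` of a complex number, with the value `1` at `z = 0`. -/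
noncomputable def unitPhase (z : ℂ) : ℂ := if z = 0 then 1 else z / ‖z‖

theorem norm_unitPhase (z : ℂ) : ‖unitPhase z‖ = 1 := by
  unfold unitPhase
  split_ifs with h
  · simp
  · simp [h]

theorem measurable_unitPhase : Measurable unitPhase :=
  Measurable.ite (measurableSet_singleton 0) measurable_const
    (measurable_id.div (Complex.measurable_ofReal.comp measurable_norm))

theorem conj_unitPhase_mul_self (z : ℂ) :
    (starRingEnd ℂ) (unitPhase z) * unitPhase z = 1 := by
  rw [mul_comm, Complex.mul_conj, Complex.normSq_eq_norm_sq, norm_unitPhase]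
  simp

theorem conj_unitPhase_mul (z : ℂ) : (starRingEnd ℂ) (unitPhase z) * z = ‖z‖ := by
  unfold unitPhase
  split_ifs with h
  · simp [h]
  · have h' : (‖z‖ : ℂ) ≠ 0 := by simpa using h
    rw [map_div₀, Complex.conj_ofReal, div_mul_eq_mul_div, mul_comm, Complex.mul_conj,
      Complex.normSq_eq_norm_sq]
    push_cast
    field_simp

/-- The reflection `v ↦ v - 2 ⟪u, v⟫ / ‖u‖² u`; it is the identity if `u = 0`. -/
noncomputable def householder (u : E) : E →L[ℂ] E :=
  ContinuousLinearMap.id ℂ E - (2 / (‖u‖ : ℂ) ^ 2) • InnerProductSpace.rankOne ℂ u u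

theorem householder_apply (u v : E) :
    householder u v = v - (2 / (‖u‖ : ℂ) ^ 2 * ⟪u, v⟫_ℂ) • u := by
  simp [householder, InnerProductSpace.rankOne_apply, smul_smul]

theorem norm_householder_apply (u v : E) : ‖householder u v‖ = ‖v‖ := by
  rcases eq_or_ne u 0 with rfl | hu
  · simp [householder_apply]
  have hu' : (‖u‖ : ℂ) ≠ 0 := by simpa using hu
  -- The two cross terms contribute `-4 |⟪u, v⟫|² / ‖u‖²`, which cancels the square of the
  -- subtracted term.
  have h : ⟪householder u v, householder u v⟫_ℂ = ⟪v, v⟫_ℂ := by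
    rw [householder_apply]
    simp only [inner_sub_left, inner_sub_right, inner_smul_left, inner_smul_right]
    rw [inner_self_eq_norm_sq_to_K u]
    simp only [map_mul, map_div₀, map_pow, map_ofNat, inner_conj_symm, Complex.coe_algebraMap,
      Complex.conj_ofReal]
    field_simp
    ring
  rw [inner_self_eq_norm_sq_to_K, inner_self_eq_norm_sq_to_K] at h
  have h' : ‖householder u v‖ ^ 2 = ‖v‖ ^ 2 := by exact_mod_cast h
  exact (sq_eq_sq₀ (norm_nonneg _) (norm_nonneg _)).1 h'

/-- Equal norms and a real inner product give `‖a - c‖² = 2 ⟪a - c, a⟫`, so the reflection subtracts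
exactly `a - c` from `a`. Over `ℂ` equal norms alone do not suffice, hence the hypothesis `hr`. -/
theorem householder_sub_apply {a c : E} (hn : ‖a‖ = ‖c‖) (hr : ⟪a, c⟫_ℂ = ⟪c, a⟫_ℂ) :
    householder (a - c) a = c := by
  rcases eq_or_ne (a - c) 0 with h | h
  · rw [h, householder_apply]
    simpa using sub_eq_zero.1 h
  have h' : (‖a - c‖ : ℂ) ^ 2 ≠ 0 := by simpa using h
  have hsq : (‖a - c‖ : ℂ) ^ 2 = 2 * ⟪a - c, a⟫_ℂ := by
    have e : ⟪a - c, a - c⟫_ℂ = (‖a - c‖ : ℂ) ^ 2 := inner_self_eq_norm_sq_to_K (a - c)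
    rw [← e]
    simp only [inner_sub_left, inner_sub_right]
    rw [inner_self_eq_norm_sq_to_K a, inner_self_eq_norm_sq_to_K c, hn, hr]
    ring
  rw [householder_apply, div_mul_eq_mul_div, ← hsq, div_self h', one_smul, sub_sub_cancel]

/-- A unitary operator which sends `a` to `b` if `‖a‖ = ‖b‖`. -/
noncomputable def phaseReflection (a b : E) : E →L[ℂ] E :=
  unitPhase ⟪a, b⟫_ℂ • householder (a - (starRingEnd ℂ) (unitPhase ⟪a, b⟫_ℂ) • b)

theorem norm_phaseReflection_apply (a b v : E) : ‖phaseReflection a b v‖ = ‖v‖ := by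
  simp [phaseReflection, norm_smul, norm_unitPhase, norm_householder_apply]

/-- With `p` the phase of `⟪a, b⟫`, the vector `c = conj p • b` satisfies `⟪a, c⟫ = |⟪a, b⟫|`, which
is real. The reflection therefore sends `a` to `c`, and the outer factor `p` turns `c` back into
`b`. -/
theorem phaseReflection_apply_left {a b : E} (h : ‖a‖ = ‖b‖) : phaseReflection a b a = b := by
  have e := conj_unitPhase_mul ⟪a, b⟫_ℂ
  have e' := congrArg (starRingEnd ℂ) e
  rw [phaseReflection, smul_apply, householder_sub_apply, smul_smul, mul_comm,
    conj_unitPhase_mul_self, one_smul]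
  · simp [norm_smul, norm_unitPhase, h]
  · rw [inner_smul_right, inner_smul_left, ← inner_conj_symm b a, ← map_mul, e]
    simp

end Householder


namespace MeasurableHilbertField

variable {Ω : Type*} [MeasurableSpace Ω] {μ : Measure Ω} {K : Ω → Type*}
  [∀ x, NormedAddCommGroup (K x)] [∀ x, InnerProductSpace ℂ (K x)]

/-! ## The canonical spectral measure and decomposable operators -/

namespace DirectIntegral

variable {F : MeasurableHilbertField μ K}

theorem norm_eq_norm_rep (ψ : F.DirectIntegral) : ‖ψ‖ = ‖ψ.rep‖ := by
  conv_lhs => rw [← ψ.mk_rep]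
  exact SeparationQuotient.norm_mk _

theorem rep_mk (ξ : F.L2Field) :
    ∀ᵐ x ∂μ, rep (SeparationQuotient.mk ξ : F.DirectIntegral) x = ξ x :=
  (mk_eq_mk_iff _ _).1 (mk_rep _)

theorem ext_rep {ψ χ : F.DirectIntegral} (h : ∀ᵐ x ∂μ, ψ.rep x = χ.rep x) : ψ = χ := by
  rw [← ψ.mk_rep, ← χ.mk_rep]
  exact (mk_eq_mk_iff _ _).2 h

theorem rep_canonicalPVM (X : Set Ω) (hX : MeasurableSet X) (ψ : F.DirectIntegral) :
    ∀ᵐ x ∂μ, (canonicalPVM F X hX ψ).rep x = X.indicator (fun _ => (1 : ℂ)) x • ψ.rep x := by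
  have h := rep_mk (L2Field.indicator X hX ψ.rep)
  rwa [← canonicalPVM_mk, mk_rep] at h

theorem norm_canonicalPVM_sq (X : Set Ω) (hX : MeasurableSet X) (ψ : F.DirectIntegral) :
    ‖canonicalPVM F X hX ψ‖ ^ 2 = ∫ x in X, ‖ψ.rep x‖ ^ 2 ∂μ := by
  rw [norm_eq_norm_rep, L2Field.norm_sq_eq, ← integral_indicator hX]
  refine integral_congr_ae ?_
  filter_upwards [rep_canonicalPVM X hX ψ] with x hx
  rw [hx]
  by_cases h : x ∈ X <;> simp [h]

/-- Both sides are the integral of `‖ψ(x)‖²` over `X`. This turns `⟪φ, M(X) φ⟫` into a squared norm.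
-/
theorem inner_canonicalPVM_self (X : Set Ω) (hX : MeasurableSet X) (ψ : F.DirectIntegral) :
    ⟪ψ, canonicalPVM F X hX ψ⟫_ℂ = (‖canonicalPVM F X hX ψ‖ ^ 2 : ℝ) := by
  have h : ⟪ψ, canonicalPVM F X hX ψ⟫_ℂ = ⟪ψ.rep, L2Field.indicator X hX ψ.rep⟫_ℂ := by
    conv_lhs => rw [← ψ.mk_rep, canonicalPVM_mk]
    exact SeparationQuotient.inner_mk_mk _ _
  rw [h, L2Field.inner_def, norm_canonicalPVM_sq, ← integral_complex_ofReal,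
    ← integral_indicator hX]
  refine integral_congr_ae (ae_of_all _ fun x => ?_)
  simp only [L2Field.indicator_apply]
  by_cases h : x ∈ X <;> simp [h, inner_self_eq_norm_sq_to_K]

/-- Decomposable operators commute with the canonical spectral measure. -/
theorem IsDecomposable.apply_canonicalPVM {W : F.DirectIntegral →L[ℂ] F.DirectIntegral}
    (hW : IsDecomposable W) (X : Set Ω) (hX : MeasurableSet X) (ψ : F.DirectIntegral) :
    W (canonicalPVM F X hX ψ) = canonicalPVM F X hX (W ψ) := by
  obtain ⟨D, -, hD⟩ := hW
  refine ext_rep ?_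
  filter_upwards [hD (canonicalPVM F X hX ψ), hD ψ, rep_canonicalPVM X hX ψ,
    rep_canonicalPVM X hX (W ψ)] with x h1 h2 h3 h4
  rw [h1, h3, h4, h2, map_smul]

/-- The squared fibre norms are integrable densities with the same integral over every measurable
set, so they agree almost everywhere. -/
theorem ae_norm_rep_eq {ψ χ : F.DirectIntegral}
    (h : ∀ (X : Set Ω) (hX : MeasurableSet X),
      ‖canonicalPVM F X hX ψ‖ = ‖canonicalPVM F X hX χ‖) :
    ∀ᵐ x ∂μ, ‖ψ.rep x‖ = ‖χ.rep x‖ := by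
  have key : (fun x => ‖ψ.rep x‖ ^ 2) =ᵐ[μ] fun x => ‖χ.rep x‖ ^ 2 := by
    refine Integrable.ae_eq_of_forall_setIntegral_eq _ _ ψ.rep.memLp.integrable_sq
      χ.rep.memLp.integrable_sq fun X hX _ => ?_
    rw [← norm_canonicalPVM_sq X hX, ← norm_canonicalPVM_sq X hX, h X hX]
  filter_upwards [key] with x hx
  exact (sq_eq_sq₀ (norm_nonneg _) (norm_nonneg _)).1 hx

/-! ### Direct integrals of fields of isometries. -/

variable {D : ∀ x, K x →L[ℂ] K x}

theorem WeaklyMeasurable.apply_mem_sections (hD : WeaklyMeasurable F D) {ξ : ∀ x, K x}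
    (hξ : ξ ∈ F.sections) : (fun x => D x (ξ x)) ∈ F.sections :=
  F.mem_of_inner _ fun η hη => hD η hη ξ hξ

/-- The action of a weakly measurable field of isometries on square-integrable fields. -/
noncomputable def isometryFieldL2 (hD : WeaklyMeasurable F D) (hn : ∀ x v, ‖D x v‖ = ‖v‖) :
    F.L2Field →ₗᵢ[ℂ] F.L2Field where
  toFun ξ := ⟨fun x => D x (ξ x), hD.apply_mem_sections ξ.mem_sections, by
    simpa only [hn] using ξ.memLp⟩
  map_add' ξ η := Subtype.ext (funext fun x => map_add (D x) _ _)
  map_smul' c ξ := Subtype.ext (funext fun x => map_smul (D x) _ _)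
  norm_map' ξ := by
    refine (sq_eq_sq₀ (norm_nonneg _) (norm_nonneg _)).1 ?_
    rw [L2Field.norm_sq_eq, L2Field.norm_sq_eq]
    exact integral_congr_ae (ae_of_all _ fun x => congrArg (· ^ 2) (hn x (ξ x)))

/-- The direct integral `∫^⊕ D x dμ(x)` of a weakly measurable field of isometries. -/
noncomputable def ofIsometryField (hD : WeaklyMeasurable F D) (hn : ∀ x v, ‖D x v‖ = ‖v‖) :
    F.DirectIntegral →L[ℂ] F.DirectIntegral :=
  SeparationQuotient.liftCLM
    ((SeparationQuotient.mkCLM ℂ F.L2Field).comp (isometryFieldL2 hD hn).toContinuousLinearMap)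
    (fun _ _ h => SeparationQuotient.mk_eq_mk.2 (h.map (isometryFieldL2 hD hn).continuous))

theorem ofIsometryField_mk (hD : WeaklyMeasurable F D) (hn : ∀ x v, ‖D x v‖ = ‖v‖)
    (ξ : F.L2Field) : ofIsometryField hD hn (SeparationQuotient.mk ξ) =
      SeparationQuotient.mk (isometryFieldL2 hD hn ξ) := rfl

theorem rep_ofIsometryField (hD : WeaklyMeasurable F D) (hn : ∀ x v, ‖D x v‖ = ‖v‖)
    (ψ : F.DirectIntegral) : ∀ᵐ x ∂μ, (ofIsometryField hD hn ψ).rep x = D x (ψ.rep x) := by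
  have h := rep_mk (isometryFieldL2 hD hn ψ.rep)
  rwa [← ofIsometryField_mk, mk_rep] at h

theorem isDecomposable_ofIsometryField (hD : WeaklyMeasurable F D)
    (hn : ∀ x v, ‖D x v‖ = ‖v‖) : IsDecomposable (ofIsometryField hD hn) :=
  ⟨D, hD, rep_ofIsometryField hD hn⟩

theorem isometry_ofIsometryField (hD : WeaklyMeasurable F D) (hn : ∀ x v, ‖D x v‖ = ‖v‖) :
    Isometry (ofIsometryField hD hn) := by
  refine AddMonoidHomClass.isometry_of_norm _ fun ψ => ?_
  conv_lhs => rw [← ψ.mk_rep, ofIsometryField_mk]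
  rw [norm_eq_norm_rep ψ, ← (isometryFieldL2 hD hn).norm_map ψ.rep]
  exact SeparationQuotient.norm_mk _

/-- With `p` the phase of `⟪a, b⟫` and `u = a - conj p • b`, the matrix coefficient is `p (⟪ξ, η⟫ -
2 / ‖u‖² ⟪u, η⟫ ⟪ξ, u⟫)` at each point. It is built by measurable operations from norms and inner
products of measurable fields. -/
theorem weaklyMeasurable_phaseReflection {a b : ∀ x, K x} (ha : a ∈ F.sections)
    (hb : b ∈ F.sections) : WeaklyMeasurable F fun x => phaseReflection (a x) (b x) := by
  intro ξ hξ η hη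
  have hp : AEMeasurable (fun x => unitPhase ⟪a x, b x⟫_ℂ) μ :=
    measurable_unitPhase.comp_aemeasurable (F.aemeasurable_inner ha hb)
  have hu : (fun x => a x - (starRingEnd ℂ) (unitPhase ⟪a x, b x⟫_ℂ) • b x) ∈ F.sections :=
    F.sections.sub_mem ha
      (F.smul_mem_sections (Complex.continuous_conj.measurable.comp_aemeasurable hp) hb)
  have hnu := Complex.measurable_ofReal.comp_aemeasurable (F.aemeasurable_norm _ hu)
  refine (hp.mul ((F.aemeasurable_inner hξ hη).sub
    (((aemeasurable_const (b := (2 : ℂ)).div (hnu.pow_const 2)).mul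
      (F.aemeasurable_inner hu hη)).mul (F.aemeasurable_inner hξ hu)))).congr
    (ae_of_all _ fun x => ?_)
  simp only [phaseReflection, smul_apply, householder_apply]
  rw [inner_smul_right, inner_sub_right, inner_smul_right]
  rfl

/-- Two elements with the same fibre norms are related by a decomposable isometry. -/
theorem exists_isDecomposable_isometry_apply_eq {ψ χ : F.DirectIntegral}
    (h : ∀ᵐ x ∂μ, ‖ψ.rep x‖ = ‖χ.rep x‖) :
    ∃ W : F.DirectIntegral →L[ℂ] F.DirectIntegral, IsDecomposable W ∧ Isometry W ∧ W ψ = χ := by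
  have hD := weaklyMeasurable_phaseReflection (F := F) ψ.rep.mem_sections χ.rep.mem_sections
  -- The operators are isometric at every point, even on the null set where the fibre norms differ,
  -- so the field needs no correction there.
  have hn : ∀ x v, ‖phaseReflection (ψ.rep x) (χ.rep x) v‖ = ‖v‖ :=
    fun x v => norm_phaseReflection_apply _ _ v
  refine ⟨ofIsometryField hD hn, isDecomposable_ofIsometryField hD hn,
    isometry_ofIsometryField hD hn, ext_rep ?_⟩
  filter_upwards [rep_ofIsometryField hD hn ψ, h] with x hx hx'
  rw [hx, phaseReflection_apply_left hx']

end DirectIntegral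

end MeasurableHilbertField

/-! ## Pure states -/

section Quantum

open MeasurableHilbertField

variable {H : Type*} [NormedAddCommGroup H] [InnerProductSpace ℂ H] [CompleteSpace H]

/-- Evaluating the two equal projections at `η` gives `⟪φ, η⟫ • φ = η`, so the phase is `⟪φ, η⟫`. -/
theorem pureState_eq_iff {φ η : H} (hφ : ‖φ‖ = 1) (hη : ‖η‖ = 1) :
    pureState φ hφ = pureState η hη ↔ ∃ t : ℂ, ‖t‖ = 1 ∧ η = t • φ := by
  constructor
  · intro h
    have h1 : InnerProductSpace.rankOne ℂ φ φ = InnerProductSpace.rankOne ℂ η η :=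
      congrArg QState.op h
    have h2 : ⟪φ, η⟫_ℂ • φ = η := by
      have := DFunLike.congr_fun h1 η
      simpa [InnerProductSpace.rankOne_apply, inner_self_eq_norm_sq_to_K, hη] using this
    refine ⟨⟪φ, η⟫_ℂ, ?_, h2.symm⟩
    simpa [norm_smul, hφ, hη] using congrArg norm h2
  · rintro ⟨t, ht, rfl⟩
    have h : InnerProductSpace.rankOne ℂ φ φ = InnerProductSpace.rankOne ℂ (t • φ) (t • φ) := by
      ext v
      have e : (starRingEnd ℂ) t * t = 1 := by
        rw [mul_comm, Complex.mul_conj, Complex.normSq_eq_norm_sq, ht]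
        simp
      simp only [InnerProductSpace.rankOne_apply, inner_smul_left, smul_smul]
      rw [mul_right_comm, e, one_mul]
    simp only [pureState, h]

namespace POVM

variable {Ω : Type*} [MeasurableSpace Ω] {μ : Measure Ω} {K : Ω → Type*}
  [∀ x, NormedAddCommGroup (K x)] [∀ x, InnerProductSpace ℂ (K x)] [∀ x, CompleteSpace (K x)]
  {M : POVM H Ω} {F : MeasurableHilbertField μ K} {J : H →ₗᵢ[ℂ] F.DirectIntegral}

namespace IsMinimalDirectIntegralDilation

/-- `tr[|φ⟩⟨φ| M(X)] = ⟪φ, J* P(X) J φ⟫ = ⟪J φ, P(X) J φ⟫`. -/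
theorem prob_pureState (hJ : M.IsMinimalDirectIntegralDilation F J) {φ : H} (hφ : ‖φ‖ = 1)
    (X : Set Ω) (hX : MeasurableSet X) :
    M.prob (pureState φ hφ) X = (‖DirectIntegral.canonicalPVM F X hX (J φ)‖ ^ 2 : ℝ) := by
  rw [← DirectIntegral.inner_canonicalPVM_self]
  refine (opTrace_rankOne_comp φ (M.toFun X)).trans ?_
  rw [hJ.1 X hX]
  exact ContinuousLinearMap.adjoint_inner_right J.toContinuousLinearMap φ _

theorem prob_pureState_eq_iff (hJ : M.IsMinimalDirectIntegralDilation F J) {φ η : H}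
    (hφ : ‖φ‖ = 1) (hη : ‖η‖ = 1) (X : Set Ω) (hX : MeasurableSet X) :
    M.prob (pureState φ hφ) X = M.prob (pureState η hη) X ↔
      ‖DirectIntegral.canonicalPVM F X hX (J φ)‖ = ‖DirectIntegral.canonicalPVM F X hX (J η)‖ := by
  rw [hJ.prob_pureState hφ X hX, hJ.prob_pureState hη X hX, Complex.ofReal_inj,
    sq_eq_sq₀ (norm_nonneg _) (norm_nonneg _)]

theorem isInfoCompleteWithin_pureStates_iff (hJ : M.IsMinimalDirectIntegralDilation F J) :
    M.IsInfoCompleteWithin (pureStates H) ↔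
      ∀ W : F.DirectIntegral →L[ℂ] F.DirectIntegral,
        DirectIntegral.IsDecomposable W → Isometry W →
        ∀ φ : H, (∀ t : ℂ, ‖t‖ = 1 → W (J φ) ≠ t • J φ) → W (J φ) ∉ Set.range J := by
  constructor
  · rintro hM W hW hiso φ hne ⟨η, hη⟩
    have hnorm (v) : ‖W v‖ = ‖v‖ := hiso.norm_map_of_map_zero (map_zero W) v
    have hφ0 : φ ≠ 0 := by
      rintro rfl
      -- The zero vector violates the hypothesis on phases already at `t = 1`.
      exact hne 1 norm_one (by simp)
    have hηφ : ‖η‖ = ‖φ‖ := by rw [← J.norm_map, hη, hnorm, J.norm_map]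
    -- Here `φ` is any nonzero vector, whereas states need unit vectors. Since `‖η‖ = ‖φ‖`, the same
    -- scalar normalizes both.
    set c : ℂ := (‖φ‖ : ℂ)⁻¹ with hc
    have hc0 : c ≠ 0 := by simpa [hc] using hφ0
    have hφ1 : ‖c • φ‖ = 1 := by simp [hc, norm_smul, hφ0]
    have hη1 : ‖c • η‖ = 1 := by rw [norm_smul, hηφ, ← norm_smul, hφ1]
    have hWc : J (c • η) = W (J (c • φ)) := by simp [hη]
    by_cases heq : pureState (c • φ) hφ1 = pureState (c • η) hη1
    · obtain ⟨t, ht, h⟩ := (pureState_eq_iff hφ1 hη1).1 heq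
      refine hne t ht ?_
      rw [smul_comm] at h
      rw [← hη, smul_right_injective H hc0 h, map_smul]
    · obtain ⟨X, hX, h⟩ := hM _ ⟨_, hφ1, rfl⟩ _ ⟨_, hη1, rfl⟩ heq
      refine h ((hJ.prob_pureState_eq_iff hφ1 hη1 X hX).2 ?_)
      rw [hWc, ← hW.apply_canonicalPVM, hnorm]
  · rintro h ρ ⟨φ, hφ, rfl⟩ σ ⟨η, hη, rfl⟩ hne
    by_contra! hprob
    obtain ⟨W, hW, hiso, hWφ⟩ := DirectIntegral.exists_isDecomposable_isometry_apply_eq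
      (DirectIntegral.ae_norm_rep_eq fun X hX =>
        (hJ.prob_pureState_eq_iff hφ hη X hX).1 (hprob X hX))
    -- `W J φ = J η` lies in the range of `J`, so by `h` it must be a phase times `J φ`; then the
    -- two states are equal.
    refine h W hW hiso φ (fun t ht hWt => hne ?_) ⟨η, hWφ.symm⟩
    refine (pureState_eq_iff hφ hη).2 ⟨t, ht, J.injective ?_⟩
    rw [← hWφ, hWt, map_smul]

end IsMinimalDirectIntegralDilation

end POVM

/-! ### Passage to the third condition. -/

/-- The adjoint of an isometry is norm-decreasing, strictly so outside of its range. -/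
theorem LinearIsometry.norm_adjoint_apply_lt_iff {H₁ H₂ : Type*} [NormedAddCommGroup H₁]
    [InnerProductSpace ℂ H₁] [CompleteSpace H₁] [NormedAddCommGroup H₂] [InnerProductSpace ℂ H₂]
    [CompleteSpace H₂] (J : H₁ →ₗᵢ[ℂ] H₂) (v : H₂) :
    ‖ContinuousLinearMap.adjoint J.toContinuousLinearMap v‖ < ‖v‖ ↔ v ∉ Set.range J := by
  set w := ContinuousLinearMap.adjoint J.toContinuousLinearMap v with hw
  have hin (z : H₁) : ⟪J z, v⟫_ℂ = ⟪z, w⟫_ℂ :=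
    (ContinuousLinearMap.adjoint_inner_right J.toContinuousLinearMap z v).symm
  -- `J w` is the orthogonal projection of `v` onto the range of `J`, so this is Pythagoras; the
  -- defect `v - J w` vanishes only if `v` is in the range.
  have hpyth : ‖v‖ ^ 2 = ‖w‖ ^ 2 + ‖v - J w‖ ^ 2 := by
    have h := norm_sub_sq (𝕜 := ℂ) v (J w)
    rw [inner_re_symm, hin, inner_self_eq_norm_sq, J.norm_map] at h
    linarith
  constructor
  · rintro hlt ⟨z, rfl⟩
    have hz : w = z := ext_inner_left ℂ fun y => by rw [← hin, J.inner_map_map]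
    rw [hz, J.norm_map] at hlt
    exact lt_irrefl _ hlt
  · intro hv
    have h0 : v - J w ≠ 0 := fun h => hv ⟨w, (sub_eq_zero.1 h).symm⟩
    have := norm_pos_iff.2 h0
    exact lt_of_pow_lt_pow_left₀ 2 (norm_nonneg _) (by rw [hpyth]; nlinarith)

end Quantum

theorem mainTheorem8 {Ω : Type*} [MeasurableSpace Ω]
    {H : Type*} [NormedAddCommGroup H] [InnerProductSpace ℂ H] [CompleteSpace H]
    [TopologicalSpace.SeparableSpace H]
    (M : POVM H Ω) (μ : Measure Ω) [SigmaFinite μ] {K : Ω → Type*}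
    [∀ x, NormedAddCommGroup (K x)] [∀ x, InnerProductSpace ℂ (K x)] [∀ x, CompleteSpace (K x)]
    (F : MeasurableHilbertField μ K) (J : H →ₗᵢ[ℂ] F.DirectIntegral)
    (hJ : M.IsMinimalDirectIntegralDilation F J) :
    (M.IsInfoCompleteWithin (pureStates H) ↔
      ∀ W : F.DirectIntegral →L[ℂ] F.DirectIntegral,
        MeasurableHilbertField.DirectIntegral.IsDecomposable W → Isometry W →
        ∀ φ : H, (∀ t : ℂ, ‖t‖ = 1 → W (J φ) ≠ t • J φ) → W (J φ) ∉ Set.range J) ∧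
    (M.IsInfoCompleteWithin (pureStates H) ↔
      ∀ W : F.DirectIntegral →L[ℂ] F.DirectIntegral,
        MeasurableHilbertField.DirectIntegral.IsDecomposable W → Isometry W →
        ∀ φ : H, (∀ t : ℂ, ‖t‖ = 1 → W (J φ) ≠ t • J φ) →
          ‖(ContinuousLinearMap.adjoint J.toContinuousLinearMap).comp
            (W.comp J.toContinuousLinearMap) φ‖ < ‖φ‖) := by
  refine ⟨hJ.isInfoCompleteWithin_pureStates_iff, hJ.isInfoCompleteWithin_pureStates_iff.trans ?_⟩
  refine forall_congr' fun W => imp_congr_right fun _ => imp_congr_right fun hiso =>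
    forall_congr' fun φ => imp_congr_right fun _ => ?_
  have hnorm : ‖W (J φ)‖ = ‖φ‖ := by
    rw [hiso.norm_map_of_map_zero (map_zero W), J.norm_map]
  rw [← J.norm_adjoint_apply_lt_iff (W (J φ)), hnorm]
  rfl
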